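/- Let $\alpha_1,\alpha_2,\lambda_1,\lambda_2>0$ with $1/3<\lambda_2/\lambda_1<2$, and let $X\sim\mathrm{Gamma}(\alpha_1,\lambda_1)$ and $Y\sim\mathrm{Gamma}(\alpha_2,\lambda_2)$ be independent random variables, where $\mathrm{Gamma}(\alpha,\lambda)$ has density $\frac{\lambda^{\alpha}}{\Gamma(\alpha)}x^{\alpha-1}e^{-\lambda x}$ on $(0,\infty)$. Write $\mathrm B(a,b)=\int_0^1 t^{a-1}(1-t)^{b-1}\,dt=\Gamma(a)\Gamma(b)/\Gamma(a+b)$ for $a,b>0$, and ${}_2F_1(a,b;c;z)=\sum_{n=0}^{\infty}\frac{(a)_n(b)_n}{(c)_n}\frac{z^n}{n!}$ for $|z|<1$, where $(q)_n=q(q+1)\cdots(q+n-1)$. Then $|X-Y|/(X+Y)$ is integrable, the two integrals over $(0,\infty)$ below converge absolutely, and $$ \begin{aligned} \mathbb E\!\left[\frac{|X-Y|}{X+Y}\right] ={}&\frac{\alpha_2\lambda_2^{\alpha_2}}{\lambda_1^{\alpha_2}(\alpha_1+\alpha_2)}\,{}_2F_1\!\left(\alpha_2+1,\alpha_1+\alpha_2;\alpha_1+\alpha_2+1;1-\frac{\lambda_2}{\lambda_1}\right)\\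 &-\frac{\alpha_1\lambda_2^{\alpha_2}}{\lambda_1^{\alpha_2}(\alpha_1+\alpha_2)}\,{}_2F_1\!\left(\alpha_2,\alpha_1+\alpha_2;\alpha_1+\alpha_2+1;1-\frac{\lambda_2}{\lambda_1}\right)\\ &+\frac{2\lambda_1^{\alpha_1}\lambda_2^{\alpha_2}}{\mathrm B(\alpha_1,\alpha_2+1)}\int_0^\infty\frac{{}_2F_1\!\left(\alpha_1+\alpha_2+1,1;\alpha_2+1;\frac{x+\lambda_2}{2x+\lambda_1+\lambda_2}\right)}{(2x+\lambda_1+\lambda_2)^{\alpha_1+\alpha_2+1}}\,dx\\ &-\frac{2\lambda_1^{\alpha_1}\lambda_2^{\alpha_2}}{\mathrm B(\alpha_1,\alpha_2)}\int_0^\infty\frac{{}_2F_1\!\left(\alpha_1+\alpha_2,1;\alpha_2+1;\frac{x+\lambda_2}{2x+\lambda_1+\lambda_2}\right)}{(x+\lambda_2)(2x+\lambda_1+\lambda_2)^{\alpha_1+\alpha_2}}\,dx\\ &+\frac{\lambda_1^{\alpha_1}}{2^{\alpha_1+\alpha_2-1}\lambda_2^{\alpha_1}(\alpha_1+\alpha_2)\,\mathrm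 B(\alpha_1,\alpha_2)}\,{}_2F_1\!\left(\alpha_1+\alpha_2,\alpha_1+\alpha_2;\alpha_1+\alpha_2+1;1-\frac{\lambda_1+\lambda_2}{2\lambda_2}\right). \end{aligned} $$ -/

import Mathlib

open MeasureTheory ProbabilityTheory

/-!
Put `s = Y / X` and `q = α₁ + α₂`. The ratio has density
`C * s ^ (α₂ - 1) * (lam₁ + lam₂ * s) ^ (-q)` on `(0, ∞)`, with
`C = lam₁ ^ α₁ * lam₂ ^ α₂ / beta α₁ α₂` (`map_div_eq_withDensity_of_gamma`), and
`|X - Y| / (X + Y) = |1 - s| / (1 + s)`. Since `|u| = -u + 2 * max u 0`, the expectation is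
`E[(s - 1) / (1 + s)] + 2 * E[(1 - s) / (1 + s); s < 1]`
(`integral_Ioi_abs_one_sub_div_mul`).

Every hypergeometric value involved is an Euler integral (`integral_euler_hypergeometric`, proved by
termwise integration of the binomial series). In the variable `s = u / (1 - u)` the first two terms
are `E[s / (1 + s)]` and `E[1 / (1 + s)]` (`integral_Ioi_rpow_div_one_add_mul_rpow`).
The functions of `x` in the third and fourth terms are, for `e = q + 1` and `e = q`
(`hypergeometric_one_div_rpow_eq_integral`), of the form
`α₂ * ∫ s in (0, 1), s ^ (α₂ - 1) * ((x + lam₁) + (x + lam₂) * s) ^ (-e)`.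
For `e = q + 1`, integrating over `x` first leaves `E[1 / (1 + s); s < 1]` up to a constant
(`integral_Ioi_integral_Ioo_rpow`). For `e = q`, an integration by parts in `s`
(`integral_Ioo_rpow_mul_add_rpow_by_parts`) produces `E[s / (1 + s); s < 1]` in the same way,
together with a boundary integral that is once more an Euler integral and equals the fifth term up
to a constant (`integral_Ioi_one_div_add_mul_rpow`), so that the two cancel.
-/

/-! ### Euler's integral for the hypergeometric function -/

theorem hasSum_ascPochhammer_mul_pow (a : ℝ) {w : ℝ} (hw : |w| < 1) :
    HasSum (fun n : ℕ => (ascPochhammer ℝ n).eval a / n.factorial * w ^ n) ((1 - w) ^ (-a)) := by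
  have h := (Real.one_div_one_sub_rpow_hasFPowerSeriesOnBall_zero a).hasSum (y := w)
    (by simpa [Metric.mem_eball, edist_dist, Real.dist_eq] using hw)
  have hw1 : 0 ≤ 1 - w := by linarith [(abs_lt.1 hw).2]
  rw [zero_add, one_div, ← Real.rpow_neg hw1] at h
  refine h.congr_fun ?_
  intro n
  have hc : Ring.choose (a + n - 1) n = (ascPochhammer ℝ n).eval a / n.factorial := by
    rw [eq_div_iff (by positivity), Ring.choose, ← Polynomial.ascPochhammer_smeval_eq_eval,
      ← Ring.factorial_nsmul_multichoose_eq_ascPochhammer, nsmul_eq_mul, mul_comm]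
    congr 2
    ring
  simp [hc, mul_comm]

theorem beta_add_natCast {b d : ℝ} (hb : 0 < b) (hd : 0 < d) (n : ℕ) :
    beta (b + n) d =
      beta b d * ((ascPochhammer ℝ n).eval b / (ascPochhammer ℝ n).eval (b + d)) := by
  induction n with
  | zero => simp
  | succ n ih =>
    have h1 : 0 < b + n := by positivity
    have h2 : 0 < b + n + d := by positivity
    have hp : 0 < (ascPochhammer ℝ n).eval (b + d) := ascPochhammer_pos n _ (by positivity)
    have h3 : beta (b + n + 1) d = beta (b + n) d * ((b + n) / (b + n + d)) := by
      have := Real.Gamma_pos_of_pos h2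
      rw [beta, beta, Real.Gamma_add_one h1.ne', show b + n + 1 + d = b + n + d + 1 by ring,
        Real.Gamma_add_one h2.ne']
      field_simp
    rw [Nat.cast_succ, ← add_assoc, h3, ih, ascPochhammer_succ_eval, ascPochhammer_succ_eval]
    rw [show b + d + n = b + n + d by ring]
    field_simp

theorem integrableOn_beta_and_integral {b d : ℝ} (hb : 0 < b) (hd : 0 < d) :
    IntegrableOn (fun t : ℝ => t ^ (b - 1) * (1 - t) ^ (d - 1)) (Set.Ioo 0 1) ∧
      ∫ t in Set.Ioo (0 : ℝ) 1, t ^ (b - 1) * (1 - t) ^ (d - 1) = beta b d := by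
  have hβ := beta_pos hb hd
  have h := lintegral_betaPDF_eq_one hb hd
  rw [lintegral_betaPDF] at h
  have hnn : 0 ≤ᵐ[volume.restrict (Set.Ioo (0 : ℝ) 1)]
      fun t : ℝ => 1 / beta b d * t ^ (b - 1) * (1 - t) ^ (d - 1) := by
    refine ae_restrict_of_forall_mem measurableSet_Ioo fun t ht => ?_
    have h0 := ht.1
    have h1 : 0 < 1 - t := sub_pos.2 ht.2
    simp only [Pi.zero_apply]
    positivity
  have hm : AEStronglyMeasurable (fun t : ℝ => 1 / beta b d * t ^ (b - 1) * (1 - t) ^ (d - 1))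
      (volume.restrict (Set.Ioo (0 : ℝ) 1)) := by fun_prop
  have hint := integral_eq_lintegral_of_nonneg_ae hnn hm
  rw [h] at hint
  have hI : Integrable (fun t : ℝ => 1 / beta b d * t ^ (b - 1) * (1 - t) ^ (d - 1))
      (volume.restrict (Set.Ioo (0 : ℝ) 1)) := by
    refine ⟨hm, ?_⟩
    rw [hasFiniteIntegral_iff_ofReal hnn, h]
    exact ENNReal.one_lt_top
  simp_rw [mul_assoc] at hint hI
  rw [integral_const_mul] at hint
  refine ⟨?_, ?_⟩
  · have := hI.const_mul (beta b d)
    refine this.congr (ae_of_all _ fun t => ?_)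
    field_simp
  · simp only [ENNReal.toReal_one] at hint
    field_simp at hint
    exact hint

/-- Euler's integral representation of `₂F₁`, obtained by expanding `(1 - z t) ^ (-a)` in its
binomial series and integrating termwise. -/
theorem integral_euler_hypergeometric {a b d z : ℝ} (ha : 0 < a) (hb : 0 < b) (hd : 0 < d)
    (hz : |z| < 1) :
    IntegrableOn (fun t : ℝ => t ^ (b - 1) * (1 - t) ^ (d - 1) * (1 - z * t) ^ (-a))
      (Set.Ioo 0 1) ∧
    ∫ t in Set.Ioo (0 : ℝ) 1, t ^ (b - 1) * (1 - t) ^ (d - 1) * (1 - z * t) ^ (-a) =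
      beta b d * ₂F₁ a b (b + d) z := by
  have hpow : ∀ n : ℕ, ∀ t ∈ Set.Ioo (0 : ℝ) 1,
      t ^ (b + n - 1) * (1 - t) ^ (d - 1) = t ^ (b - 1) * (1 - t) ^ (d - 1) * t ^ n := by
    intro n t ht
    rw [show b + n - 1 = (b - 1) + n by ring, Real.rpow_add_natCast ht.1.ne']
    ring
  have hbn : ∀ n : ℕ, 0 < b + n := fun n => by positivity
  set c : ℕ → ℝ := fun n => (ascPochhammer ℝ n).eval a / n.factorial with hc
  have hc0 : ∀ n, 0 ≤ c n := fun n =>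
    div_nonneg (ascPochhammer_pos n a ha).le (by positivity)
  let F : ℕ → ℝ → ℝ := fun n t => c n * z ^ n * (t ^ (b - 1) * (1 - t) ^ (d - 1) * t ^ n)
  have hF : ∀ n, Integrable (F n) (volume.restrict (Set.Ioo (0 : ℝ) 1)) := fun n =>
    (((integrableOn_beta_and_integral (hbn n) hd).1.congr_fun (hpow n)
      measurableSet_Ioo).integrable).const_mul _
  have hint : ∀ n : ℕ, ∫ t in Set.Ioo (0 : ℝ) 1, t ^ (b - 1) * (1 - t) ^ (d - 1) * t ^ n =
      beta (b + n) d := fun n => by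
    rw [← (integrableOn_beta_and_integral (hbn n) hd).2]
    exact setIntegral_congr_fun measurableSet_Ioo fun t ht => (hpow n t ht).symm
  have hFint : ∀ n, ∫ t in Set.Ioo (0 : ℝ) 1, F n t = c n * z ^ n * beta (b + n) d := fun n => by
    rw [integral_const_mul, hint]
  have hFnorm : ∀ n, ∫ t in Set.Ioo (0 : ℝ) 1, ‖F n t‖ = c n * |z| ^ n * beta (b + n) d :=
    fun n => by
    rw [← hint, ← integral_const_mul]
    refine setIntegral_congr_fun measurableSet_Ioo fun t ht => ?_
    have h0 := ht.1
    have h1 : 0 < 1 - t := sub_pos.2 ht.2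
    simp only [F, norm_mul, norm_pow, Real.norm_eq_abs]
    rw [abs_of_nonneg (hc0 n), abs_of_pos h0, abs_of_pos (Real.rpow_pos_of_pos h0 _),
      abs_of_pos (Real.rpow_pos_of_pos h1 _)]
  have hle : ∀ n : ℕ, beta (b + n) d ≤ beta b d := fun n => by
    rw [← hint, ← (integrableOn_beta_and_integral hb hd).2]
    refine setIntegral_mono_on ((integrableOn_beta_and_integral (hbn n) hd).1.congr_fun (hpow n)
      measurableSet_Ioo) (integrableOn_beta_and_integral hb hd).1 measurableSet_Ioo fun t ht => ?_
    have h0 := ht.1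
    have h1 : 0 < 1 - t := sub_pos.2 ht.2
    exact mul_le_of_le_one_right (by positivity) (pow_le_one₀ h0.le ht.2.le)
  -- The norms are dominated by `beta b d` times the terms of the binomial series at `|z|`.
  have hsum : Summable fun n => ∫ t in Set.Ioo (0 : ℝ) 1, ‖F n t‖ := by
    refine Summable.of_nonneg_of_le (fun n => integral_nonneg fun _ => norm_nonneg _) (fun n => ?_)
      ((hasSum_ascPochhammer_mul_pow a (w := |z|) (by rwa [abs_abs])).summable.mul_right (beta b d))
    rw [hFnorm]
    exact mul_le_mul_of_nonneg_left (hle n) (mul_nonneg (hc0 n) (by positivity))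
  -- Termwise summation under the integral sign: this is the binomial series at `z * t`.
  have htsum : ∀ t ∈ Set.Ioo (0 : ℝ) 1,
      ∑' n, F n t = t ^ (b - 1) * (1 - t) ^ (d - 1) * (1 - z * t) ^ (-a) := by
    intro t ht
    have hzt : |z * t| < 1 := by
      rw [abs_mul, abs_of_pos ht.1]
      nlinarith [abs_nonneg z, ht.1, ht.2]
    rw [← (hasSum_ascPochhammer_mul_pow a hzt).tsum_eq, ← tsum_mul_left]
    refine tsum_congr fun n => ?_
    simp only [F, hc, mul_pow]
    ring
  constructor
  · refine (integrableOn_beta_and_integral hb hd).1.mul_continuousOn_of_subset ?_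
      measurableSet_Ioo isCompact_Icc Set.Ioo_subset_Icc_self
    refine ContinuousOn.rpow_const (by fun_prop) fun t ht => Or.inl ?_
    have : z * t < 1 := by
      have := abs_lt.1 hz
      nlinarith [ht.1, ht.2]
    linarith
  · rw [← setIntegral_congr_fun measurableSet_Ioo htsum,
      ← (hasSum_integral_of_summable_integral_norm hF hsum).tsum_eq,
      ordinaryHypergeometric_eq_tsum, ← tsum_mul_left]
    refine tsum_congr fun n => ?_
    rw [hFint, beta_add_natCast hb hd, smul_eq_mul, hc]
    ring

/-! ### Changes of variables -/

theorem image_div_add_Ioi {c : ℝ} (hc : 0 < c) :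
    (fun s : ℝ => s / (c + s)) '' Set.Ioi 0 = Set.Ioo 0 1 := by
  ext u
  constructor
  · rintro ⟨s, hs, rfl⟩
    have hs : 0 < s := hs
    exact ⟨by positivity, by rw [div_lt_one (by positivity)]; linarith⟩
  · rintro ⟨h0, h1⟩
    have h1 : 0 < 1 - u := sub_pos.2 h1
    refine ⟨c * u / (1 - u), Set.mem_Ioi.2 (by positivity), ?_⟩
    field_simp
    ring

theorem hasDerivWithinAt_div_add {c : ℝ} (hc : 0 < c) :
    ∀ s ∈ Set.Ioi (0 : ℝ), HasDerivWithinAt (fun s : ℝ => s / (c + s)) (c / (c + s) ^ 2)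
      (Set.Ioi 0) s := by
  intro s hs
  have hs : 0 < s := hs
  have h := ((hasDerivAt_id s).div ((hasDerivAt_id s).const_add c)
    (by simp only [id]; positivity)).hasDerivWithinAt (s := Set.Ioi 0)
  refine h.congr_deriv ?_
  simp

theorem injOn_div_add {c : ℝ} (hc : 0 < c) :
    Set.InjOn (fun s : ℝ => s / (c + s)) (Set.Ioi 0) := by
  intro s hs t ht h
  have hs : 0 < s := hs
  have ht : 0 < t := ht
  simp only at h
  rw [div_eq_div_iff (by positivity) (by positivity)] at h
  exact mul_left_cancel₀ hc.ne' (by linarith)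

/-- The substitution `u = s / (c + s)`, carrying `(0, ∞)` onto `(0, 1)`. -/
theorem integral_Ioo_eq_integral_Ioi_div_add {c : ℝ} (hc : 0 < c) (f : ℝ → ℝ) :
    ∫ u in Set.Ioo (0 : ℝ) 1, f u = ∫ s in Set.Ioi (0 : ℝ), c / (c + s) ^ 2 * f (s / (c + s)) := by
  rw [← image_div_add_Ioi hc, integral_image_eq_integral_abs_deriv_smul measurableSet_Ioi
    (hasDerivWithinAt_div_add hc) (injOn_div_add hc)]
  refine setIntegral_congr_fun measurableSet_Ioi fun s _ => ?_
  simp only [smul_eq_mul]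
  rw [abs_of_nonneg (by positivity)]

theorem integrableOn_Ioo_iff_integrableOn_Ioi_div_add {c : ℝ} (hc : 0 < c) (f : ℝ → ℝ) :
    IntegrableOn f (Set.Ioo 0 1) ↔
      IntegrableOn (fun s : ℝ => c / (c + s) ^ 2 * f (s / (c + s))) (Set.Ioi 0) := by
  rw [← image_div_add_Ioi hc, integrableOn_image_iff_integrableOn_abs_deriv_smul measurableSet_Ioi
    (hasDerivWithinAt_div_add hc) (injOn_div_add hc)]
  refine integrableOn_congr_fun (fun s _ => ?_) measurableSet_Ioi
  simp only [smul_eq_mul]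
  rw [abs_of_nonneg (by positivity)]

theorem image_one_sub_Ioo : (fun t : ℝ => 1 - t) '' Set.Ioo 0 1 = Set.Ioo 0 1 := by
  simp

/-- Euler's integral after the reflection `t ↦ 1 - t`. -/
theorem integral_euler_hypergeometric_reflected {a b d z : ℝ} (ha : 0 < a) (hb : 0 < b)
    (hd : 0 < d) (hz : |z| < 1) :
    IntegrableOn (fun t : ℝ => (1 - t) ^ (b - 1) * t ^ (d - 1) * (1 - z * (1 - t)) ^ (-a))
      (Set.Ioo 0 1) ∧
    ∫ t in Set.Ioo (0 : ℝ) 1, (1 - t) ^ (b - 1) * t ^ (d - 1) * (1 - z * (1 - t)) ^ (-a) =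
      beta b d * ₂F₁ a b (b + d) z := by
  obtain ⟨h1, h2⟩ := integral_euler_hypergeometric ha hb hd hz
  have hder : ∀ t ∈ Set.Ioo (0 : ℝ) 1,
      HasDerivWithinAt (fun t : ℝ => 1 - t) (-1) (Set.Ioo 0 1) t := fun t _ =>
    ((hasDerivAt_id t).const_sub 1).hasDerivWithinAt
  have hinj : Set.InjOn (fun t : ℝ => 1 - t) (Set.Ioo 0 1) := fun s _ t _ h => by
    simpa using h
  rw [← image_one_sub_Ioo, integrableOn_image_iff_integrableOn_abs_deriv_smul measurableSet_Ioo
    hder hinj] at h1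
  rw [← image_one_sub_Ioo, integral_image_eq_integral_abs_deriv_smul measurableSet_Ioo
    hder hinj] at h2
  simp only [abs_neg, abs_one, one_smul, sub_sub_cancel] at h1 h2
  exact ⟨h1, h2⟩

/-! ### The law of the ratio of two independent gamma variables -/

/-- The product of the two gamma densities along the ray `y = s x`, times the Jacobian `x`, is a
gamma density in `x` times the density of the ratio at `s`. -/
theorem gammaPDFReal_mul_gammaPDFReal_mul {a b l m s x : ℝ} (ha : 0 < a) (hb : 0 < b)
    (hl : 0 < l) (hm : 0 < m) (hs : 0 < s) (hx : 0 < x) :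
    gammaPDFReal a l x * (gammaPDFReal b m (x * s) * x) =
      l ^ a * m ^ b / beta a b * (s ^ (b - 1) * (l + m * s) ^ (-(a + b))) *
        gammaPDFReal (a + b) (l + m * s) x := by
  have hq : 0 < l + m * s := by positivity
  have hΓ := Real.Gamma_pos_of_pos (add_pos ha hb)
  have hΓa := Real.Gamma_pos_of_pos ha
  have hΓb := Real.Gamma_pos_of_pos hb
  rw [gammaPDFReal, gammaPDFReal, gammaPDFReal, if_pos hx.le, if_pos (by positivity), if_pos hx.le,
    Real.mul_rpow hx.le hs.le, Real.rpow_neg hq.le, beta,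
    show -((l + m * s) * x) = -(l * x) + -(m * (x * s)) by ring, Real.exp_add,
    show a + b - 1 = (a - 1) + (b - 1) + 1 by ring, Real.rpow_add hx, Real.rpow_add hx,
    Real.rpow_one]
  have : 0 < (l + m * s) ^ (a + b) := by positivity
  field_simp

theorem lintegral_gammaMeasure {a l : ℝ} (f : ℝ → ENNReal) (hf : Measurable f) :
    ∫⁻ x, f x ∂gammaMeasure a l = ∫⁻ x in Set.Ioi (0 : ℝ), gammaPDF a l x * f x := by
  have hm : Measurable (gammaPDF a l) := (measurable_gammaPDFReal a l).ennreal_ofReal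
  rw [gammaMeasure, lintegral_withDensity_eq_lintegral_mul _ hm hf, ← setLIntegral_univ,
    ← Set.Iio_union_Ici (a := (0 : ℝ)), lintegral_union measurableSet_Ici
    (Set.Iio_disjoint_Ici le_rfl), setLIntegral_congr Ioi_ae_eq_Ici.symm,
    setLIntegral_congr_fun measurableSet_Iio (g := fun _ => 0), lintegral_zero, zero_add]
  · rfl
  · intro x hx
    simp [gammaPDF_of_neg hx]

theorem lintegral_Ioi_comp_mul_left {x : ℝ} (hx : 0 < x) (f : ℝ → ENNReal) :
    ∫⁻ y in Set.Ioi (0 : ℝ), f y = ∫⁻ s in Set.Ioi (0 : ℝ), ENNReal.ofReal x * f (x * s) := by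
  have him : (fun s : ℝ => x * s) '' Set.Ioi 0 = Set.Ioi 0 := by
    rw [Set.image_mul_left_Ioi hx, mul_zero]
  conv_lhs => rw [← him]
  rw [lintegral_image_eq_lintegral_abs_deriv_mul (f' := fun _ => x) measurableSet_Ioi
    (fun s _ => by simpa using ((hasDerivAt_id s).const_mul x).hasDerivWithinAt)
    (fun s _ t _ h => mul_left_cancel₀ hx.ne' h)]
  simp only [abs_of_pos hx]

/-- The ratio `Y / X` of independent gamma variables has density proportional to
`s ^ (b - 1) * (l + m * s) ^ (-(a + b))` on `(0, ∞)`. -/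
theorem lintegral_comp_div_gammaMeasure {a b l m : ℝ} (ha : 0 < a) (hb : 0 < b)
    (hl : 0 < l) (hm : 0 < m) (g : ℝ → ENNReal) (hg : Measurable g) :
    ∫⁻ x, ∫⁻ y, g (y / x) ∂gammaMeasure b m ∂gammaMeasure a l =
      ∫⁻ s in Set.Ioi (0 : ℝ), ENNReal.ofReal
        (l ^ a * m ^ b / beta a b * (s ^ (b - 1) * (l + m * s) ^ (-(a + b)))) * g s := by
  have hmb : Measurable (gammaPDF b m) := (measurable_gammaPDFReal b m).ennreal_ofReal
  have hma : Measurable (gammaPDF a l) := (measurable_gammaPDFReal a l).ennreal_ofReal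
  have hG : Measurable fun x : ℝ => ∫⁻ y, g (y / x) ∂gammaMeasure b m := by
    have := isProbabilityMeasure_gammaMeasure hb hm
    exact (hg.comp (measurable_snd.div measurable_fst)).lintegral_prod_right'
  rw [lintegral_gammaMeasure _ hG]
  calc ∫⁻ x in Set.Ioi (0 : ℝ), gammaPDF a l x * ∫⁻ y, g (y / x) ∂gammaMeasure b m
      = ∫⁻ x in Set.Ioi (0 : ℝ), ∫⁻ s in Set.Ioi (0 : ℝ),
          gammaPDF a l x * (gammaPDF b m (x * s) * ENNReal.ofReal x) * g s := by
        refine setLIntegral_congr_fun measurableSet_Ioi fun x hx => ?_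
        have hx : 0 < x := hx
        rw [lintegral_gammaMeasure _ (by fun_prop), lintegral_Ioi_comp_mul_left hx,
          ← lintegral_const_mul _ (by fun_prop)]
        refine lintegral_congr fun s => ?_
        rw [mul_div_cancel_left₀ _ hx.ne']
        ring
    _ = ∫⁻ s in Set.Ioi (0 : ℝ), ∫⁻ x in Set.Ioi (0 : ℝ),
          gammaPDF a l x * (gammaPDF b m (x * s) * ENNReal.ofReal x) * g s := by
        refine lintegral_lintegral_swap (Measurable.aemeasurable ?_)
        simp only [Function.uncurry_def]
        fun_prop
    _ = _ := by
        refine setLIntegral_congr_fun measurableSet_Ioi fun s hs => ?_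
        have hs : 0 < s := hs
        have hq : 0 < l + m * s := by positivity
        have hβ := beta_pos ha hb
        have hmq : Measurable (gammaPDF (a + b) (l + m * s)) :=
          (measurable_gammaPDFReal _ _).ennreal_ofReal
        have h1 : ∫⁻ x in Set.Ioi (0 : ℝ), gammaPDF (a + b) (l + m * s) x = 1 := by
          rw [← lintegral_gammaPDF_eq_one (add_pos ha hb) hq]
          have := lintegral_gammaMeasure (a := a + b) (l := l + m * s) (fun _ => 1) measurable_const
          simpa [gammaMeasure] using this.symm
        rw [lintegral_mul_const _ (by fun_prop)]
        congr 1
        rw [← mul_one (ENNReal.ofReal _), ← h1, ← lintegral_const_mul _ hmq]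
        refine setLIntegral_congr_fun measurableSet_Ioi fun x hx => ?_
        have hx : 0 < x := hx
        simp only [gammaPDF]
        rw [← ENNReal.ofReal_mul (gammaPDFReal_nonneg hb hm _),
          ← ENNReal.ofReal_mul (gammaPDFReal_nonneg ha hl _),
          gammaPDFReal_mul_gammaPDFReal_mul ha hb hl hm hs hx, ENNReal.ofReal_mul (by positivity)]

/-- The law of the ratio of independent gamma variables. -/
theorem map_div_eq_withDensity_of_gamma {Ω : Type*} [MeasurableSpace Ω] {P : Measure Ω}
    [IsProbabilityMeasure P] {X Y : Ω → ℝ} {a b l m : ℝ} (ha : 0 < a) (hb : 0 < b)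
    (hl : 0 < l) (hm : 0 < m) (hX : HasLaw X (gammaMeasure a l) P)
    (hY : HasLaw Y (gammaMeasure b m) P) (hXY : IndepFun X Y P) :
    P.map (fun ω => Y ω / X ω) = (volume.restrict (Set.Ioi (0 : ℝ))).withDensity fun s =>
      ENNReal.ofReal (l ^ a * m ^ b / beta a b * (s ^ (b - 1) * (l + m * s) ^ (-(a + b)))) := by
  have := isProbabilityMeasure_gammaMeasure ha hl
  have := isProbabilityMeasure_gammaMeasure hb hm
  have hXm := hX.aemeasurable
  have hYm := hY.aemeasurable
  have hprod := (indepFun_iff_map_prod_eq_prod_map_map hXm hYm).1 hXY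
  rw [hX.map_eq, hY.map_eq] at hprod
  refine Measure.ext_of_lintegral _ fun g hg => ?_
  have hdiv : AEMeasurable (fun ω => Y ω / X ω) P := hYm.div hXm
  rw [lintegral_map' hg.aemeasurable hdiv,
    lintegral_withDensity_eq_lintegral_mul _ (by fun_prop) hg]
  have h2 : Measurable fun p : ℝ × ℝ => g (p.2 / p.1) := by fun_prop
  have h3 := lintegral_map' (μ := P) (f := fun p : ℝ × ℝ => g (p.2 / p.1)) h2.aemeasurable
    (hXm.prodMk hYm)
  rw [← h3, hprod, lintegral_prod _ h2.aemeasurable]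
  exact lintegral_comp_div_gammaMeasure ha hb hl hm g hg

theorem ae_pos_of_hasLaw_gammaMeasure {Ω : Type*} [MeasurableSpace Ω] {P : Measure Ω}
    {X : Ω → ℝ} {a l : ℝ} (hX : HasLaw X (gammaMeasure a l) P) : ∀ᵐ ω ∂P, 0 < X ω := by
  refine ae_of_ae_map hX.aemeasurable ?_
  rw [hX.map_eq, ae_iff, ← lintegral_indicator_one₀ (by measurability),
    lintegral_gammaMeasure _ (by measurability), setLIntegral_congr_fun measurableSet_Ioi
    (g := fun _ => 0), lintegral_zero]
  intro x hx
  have hx : 0 < x := hx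
  simp [hx]

/-! ### The five terms as integrals over the ratio -/

theorem beta_one_left {b : ℝ} (hb : 0 < b) : beta 1 b = 1 / b := by
  have := Real.Gamma_pos_of_pos hb
  rw [beta, add_comm, Real.Gamma_add_one hb.ne', Real.Gamma_one]
  field_simp

theorem beta_one_right {b : ℝ} (hb : 0 < b) : beta b 1 = 1 / b := by
  have := Real.Gamma_pos_of_pos hb
  rw [beta, Real.Gamma_add_one hb.ne', Real.Gamma_one]
  field_simp

theorem beta_comm (a b : ℝ) : beta a b = beta b a := by
  rw [beta, beta, mul_comm, add_comm]

theorem beta_add_one_left {a b : ℝ} (ha : 0 < a) (hb : 0 < b) :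
    beta (a + 1) b = beta a b * (a / (a + b)) := by
  simpa using beta_add_natCast ha hb 1

theorem beta_add_one_right {a b : ℝ} (ha : 0 < a) (hb : 0 < b) :
    beta a (b + 1) = beta a b * (b / (a + b)) := by
  rw [beta_comm, beta_add_one_left hb ha, beta_comm, add_comm]

/-- Euler's integral with `e + d = q + 1`, rewritten with the variable `s = u / (1 - u)`. -/
theorem integral_Ioi_rpow_div_one_add_mul_rpow {q e d l m : ℝ} (hq : 0 < q) (he : 0 < e)
    (hd : 0 < d) (hed : e + d = q + 1) (hl : 0 < l) (hm : 0 < m) (hz : |1 - m / l| < 1) :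
    IntegrableOn (fun s : ℝ => s ^ (e - 1) / (1 + s) * (l + m * s) ^ (-q)) (Set.Ioi 0) ∧
    ∫ s in Set.Ioi (0 : ℝ), s ^ (e - 1) / (1 + s) * (l + m * s) ^ (-q) =
      l ^ (-q) * (beta e d * ₂F₁ e q (q + 1) (1 - m / l)) := by
  obtain ⟨h1, h2⟩ := integral_euler_hypergeometric hq he hd hz
  rw [integrableOn_Ioo_iff_integrableOn_Ioi_div_add one_pos] at h1
  rw [integral_Ioo_eq_integral_Ioi_div_add one_pos, hed] at h2
  have key : ∀ s ∈ Set.Ioi (0 : ℝ),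
      l ^ (-q) * (1 / (1 + s) ^ 2 * ((s / (1 + s)) ^ (e - 1) * (1 - s / (1 + s)) ^ (d - 1) *
        (1 - (1 - m / l) * (s / (1 + s))) ^ (-q))) =
      s ^ (e - 1) / (1 + s) * (l + m * s) ^ (-q) := by
    intro s hs
    have hs : 0 < s := hs
    have hk : 0 < 1 + s := by positivity
    have e1 : 1 - s / (1 + s) = 1 / (1 + s) := by field_simp; ring
    have e2 : 1 - (1 - m / l) * (s / (1 + s)) = (l + m * s) / (l * (1 + s)) := by
      field_simp; ring
    have e3 : d - 1 = q - e := by linarith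
    rw [e1, e2, Real.div_rpow hs.le hk.le, Real.div_rpow one_pos.le hk.le,
      Real.div_rpow (by positivity) (by positivity), Real.mul_rpow hl.le hk.le, Real.one_rpow, e3,
      Real.rpow_sub_one hk.ne' e, Real.rpow_sub hk q e, Real.rpow_neg hk.le]
    field_simp
  refine ⟨IntegrableOn.congr_fun (h1.const_mul (l ^ (-q))) key measurableSet_Ioi, ?_⟩
  rw [← setIntegral_congr_fun measurableSet_Ioi key, integral_const_mul, h2, ordinaryHypergeometric,
    ordinaryHypergeometricSeries_symm, ← ordinaryHypergeometric]

/-- The integral over `x` of the boundary values that arise from the integration by parts in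
`integral_Ioo_rpow_mul_add_rpow_by_parts`, computed by the substitution `t = x / (m + x)`. -/
theorem integral_Ioi_one_div_add_mul_rpow {q l m : ℝ} (hq : 0 < q) (hl : 0 < l) (hm : 0 < m)
    (hz : |1 - (l + m) / (2 * m)| < 1) :
    IntegrableOn (fun x : ℝ => (2 * x + l + m) ^ (-q) / (x + m)) (Set.Ioi 0) ∧
    ∫ x in Set.Ioi (0 : ℝ), (2 * x + l + m) ^ (-q) / (x + m) =
      1 / (2 ^ q * m ^ q * q) * ₂F₁ q q (q + 1) (1 - (l + m) / (2 * m)) := by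
  obtain ⟨h1, h2⟩ := integral_euler_hypergeometric_reflected hq hq one_pos hz
  rw [integrableOn_Ioo_iff_integrableOn_Ioi_div_add hm] at h1
  rw [integral_Ioo_eq_integral_Ioi_div_add hm] at h2
  have key : ∀ x ∈ Set.Ioi (0 : ℝ),
      1 / (2 ^ q * m ^ q) * (m / (m + x) ^ 2 * ((1 - x / (m + x)) ^ (q - 1) *
        (x / (m + x)) ^ ((1 : ℝ) - 1) *
        (1 - (1 - (l + m) / (2 * m)) * (1 - x / (m + x))) ^ (-q))) =
      (2 * x + l + m) ^ (-q) / (x + m) := by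
    intro x hx
    have hx : 0 < x := hx
    have hk : 0 < m + x := by positivity
    have hS : 0 < 2 * x + l + m := by positivity
    have e1 : 1 - x / (m + x) = m / (m + x) := by field_simp; ring
    have e2 : 1 - (1 - (l + m) / (2 * m)) * (m / (m + x)) =
        (2 * x + l + m) / (2 * (m + x)) := by
      field_simp; ring
    rw [e1, e2, sub_self, Real.rpow_zero, Real.div_rpow hm.le hk.le,
      Real.div_rpow hS.le (by positivity), Real.mul_rpow two_pos.le hk.le,
      Real.rpow_sub_one hk.ne', Real.rpow_sub_one hm.ne', Real.rpow_neg hk.le,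
      Real.rpow_neg two_pos.le, add_comm x m]
    field_simp
  refine ⟨IntegrableOn.congr_fun (h1.const_mul (1 / (2 ^ q * m ^ q))) key measurableSet_Ioi, ?_⟩
  rw [← setIntegral_congr_fun measurableSet_Ioi key, integral_const_mul, h2, beta_one_right hq]
  field_simp

/-- The reflected Euler integral with second parameter `1`. The power of `2 * x + l + m` clears the
denominator of the argument of `₂F₁`. -/
theorem hypergeometric_one_div_rpow_eq_integral {e b l m x : ℝ} (he : 0 < e) (hb : 0 < b)
    (hl : 0 < l) (hm : 0 < m) (hx : 0 < x) :
    ₂F₁ e 1 (b + 1) ((x + m) / (2 * x + l + m)) * (2 * x + l + m) ^ (-e) =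
      b * ∫ s in Set.Ioo (0 : ℝ) 1, s ^ (b - 1) * ((x + l) + (x + m) * s) ^ (-e) := by
  have hS : 0 < 2 * x + l + m := by positivity
  have hz : |(x + m) / (2 * x + l + m)| < 1 := by
    rw [abs_of_pos (by positivity), div_lt_one hS]
    linarith
  have h := (integral_euler_hypergeometric_reflected he one_pos hb hz).2
  rw [beta_one_left hb, add_comm 1 b] at h
  have h' : ₂F₁ e 1 (b + 1) ((x + m) / (2 * x + l + m)) = b * (1 / b *
      ₂F₁ e 1 (b + 1) ((x + m) / (2 * x + l + m))) := by field_simp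
  rw [h', ← h, mul_assoc, ← integral_mul_const]
  congr 1
  refine setIntegral_congr_fun measurableSet_Ioo fun s hs => ?_
  have hs0 := hs.1
  have e1 : 1 - (x + m) / (2 * x + l + m) * (1 - s) =
      ((x + l) + (x + m) * s) / (2 * x + l + m) := by
    field_simp; ring
  have hp : 0 < (x + l) + (x + m) * s := by positivity
  rw [e1, sub_self, Real.rpow_zero, one_mul, Real.div_rpow hp.le hS.le, mul_assoc,
    div_mul_cancel₀ _ (by positivity)]

theorem integral_Ioo_rpow_mul_add_rpow_by_parts {b q p r : ℝ} (hb : 0 < b) (hp : 0 < p)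
    (hr : 0 < r) :
    b * ∫ s in Set.Ioo (0 : ℝ) 1, s ^ (b - 1) * (p + r * s) ^ (-q) =
      (p + r) ^ (-q) +
        r * (q * ∫ s in Set.Ioo (0 : ℝ) 1, s ^ b * (p + r * s) ^ (-(q + 1))) := by
  have hpos : ∀ s ∈ Set.Icc (0 : ℝ) 1, p + r * s ≠ 0 := fun s hs => by
    have := hs.1
    positivity
  have hcont : ∀ y : ℝ, ContinuousOn (fun s : ℝ => (p + r * s) ^ y) (Set.uIcc 0 1) := fun y => by
    rw [Set.uIcc_of_le zero_le_one]
    exact ContinuousOn.rpow_const (by fun_prop) fun s hs => Or.inl (hpos s hs)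
  have h1 : IntervalIntegrable (fun s : ℝ => s ^ (b - 1) * (p + r * s) ^ (-q)) volume 0 1 :=
    (intervalIntegral.intervalIntegrable_rpow' (by linarith)).mul_continuousOn (hcont _)
  have h2 : IntervalIntegrable (fun s : ℝ => s ^ b * (p + r * s) ^ (-(q + 1))) volume 0 1 :=
    (intervalIntegral.intervalIntegrable_rpow' (by linarith)).mul_continuousOn (hcont _)
  have h := intervalIntegral.integral_eq_sub_of_hasDerivAt_of_le zero_le_one
    (f := fun s : ℝ => s ^ b * (p + r * s) ^ (-q))
    (f' := fun s : ℝ => b * (s ^ (b - 1) * (p + r * s) ^ (-q)) -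
      r * q * (s ^ b * (p + r * s) ^ (-(q + 1))))
    (by
      refine ContinuousOn.mul (Real.continuous_rpow_const hb.le).continuousOn ?_
      simpa using hcont (-q))
    (fun s hs => by
      have hs0 := hs.1
      have hd := (Real.hasDerivAt_rpow_const (p := b) (Or.inl hs0.ne')).mul
        ((((hasDerivAt_id s).const_mul r).const_add p).rpow_const (p := -q)
          (Or.inl (hpos s ⟨hs.1.le, hs.2.le⟩)))
      refine hd.congr_deriv ?_
      simp only [id, neg_add']
      ring)
    ((h1.const_mul _).sub (h2.const_mul _))
  rw [intervalIntegral.integral_sub (h1.const_mul _) (h2.const_mul _),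
    intervalIntegral.integral_const_mul, intervalIntegral.integral_const_mul,
    intervalIntegral.integral_of_le zero_le_one, intervalIntegral.integral_of_le zero_le_one,
    integral_Ioc_eq_integral_Ioo, integral_Ioc_eq_integral_Ioo, Real.zero_rpow hb.ne',
    Real.one_rpow] at h
  rw [← mul_assoc r q]
  simp only [mul_one, zero_mul, one_mul, sub_zero] at h
  linear_combination h

theorem integral_Ioi_mul_add_rpow {q k c : ℝ} (hq : 0 < q) (hk : 0 < k) (hc : 0 < c) :
    IntegrableOn (fun x : ℝ => (k * x + c) ^ (-(q + 1))) (Set.Ioi 0) ∧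
      ∫ x in Set.Ioi (0 : ℝ), (k * x + c) ^ (-(q + 1)) = c ^ (-q) / (q * k) := by
  have hpos : ∀ x ∈ Set.Ici (0 : ℝ), 0 < k * x + c := fun x hx => by
    have hx : 0 ≤ x := hx
    positivity
  have hder : ∀ x ∈ Set.Ici (0 : ℝ),
      HasDerivAt (fun x : ℝ => -((k * x + c) ^ (-q)) / (q * k)) ((k * x + c) ^ (-(q + 1))) x := by
    intro x hx
    have hd := ((((hasDerivAt_id x).const_mul k).add_const c).rpow_const (p := -q)
      (Or.inl (hpos x hx).ne')).neg.div_const (q * k)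
    refine hd.congr_deriv ?_
    simp only [id, neg_add']
    field_simp
  have hnn : ∀ x ∈ Set.Ioi (0 : ℝ), 0 ≤ (k * x + c) ^ (-(q + 1)) := fun x hx =>
    Real.rpow_nonneg (hpos x (Set.Ioi_subset_Ici_self hx)).le _
  have hlim : Filter.Tendsto (fun x : ℝ => -((k * x + c) ^ (-q)) / (q * k)) Filter.atTop
      (nhds 0) := by
    have h1 : Filter.Tendsto (fun x : ℝ => k * x + c) Filter.atTop Filter.atTop :=
      Filter.tendsto_atTop_add_const_right _ _ (Filter.tendsto_id.const_mul_atTop hk)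
    simpa using (((tendsto_rpow_neg_atTop hq).comp h1).neg.div_const (q * k))
  refine ⟨integrableOn_Ioi_deriv_of_nonneg' hder hnn hlim, ?_⟩
  rw [integral_Ioi_of_hasDerivAt_of_nonneg' hder hnn hlim]
  simp [neg_div]

/-- By Fubini the integral over `x` may be taken first; as the base equals
`(1 + s) * x + (l + m * s)`, it is elementary and yields the factor `1 / (1 + s)`. -/
theorem integral_Ioi_integral_Ioo_rpow {β q l m : ℝ} (hβ : -1 < β) (hq : 0 < q) (hl : 0 < l)
    (hm : 0 < m) :
    IntegrableOn (fun x : ℝ => ∫ s in Set.Ioo (0 : ℝ) 1,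
      s ^ β * ((x + l) + (x + m) * s) ^ (-(q + 1))) (Set.Ioi 0) ∧
    ∫ x in Set.Ioi (0 : ℝ), ∫ s in Set.Ioo (0 : ℝ) 1,
        s ^ β * ((x + l) + (x + m) * s) ^ (-(q + 1)) =
      1 / q * ∫ s in Set.Ioo (0 : ℝ) 1, s ^ β / (1 + s) * (l + m * s) ^ (-q) := by
  have hre : ∀ x s : ℝ, (x + l) + (x + m) * s = (1 + s) * x + (l + m * s) := fun x s => by ring
  simp only [hre]
  have hin : ∀ s ∈ Set.Ioo (0 : ℝ) 1,
      IntegrableOn (fun x : ℝ => s ^ β * ((1 + s) * x + (l + m * s)) ^ (-(q + 1))) (Set.Ioi 0) ∧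
      ∫ x in Set.Ioi (0 : ℝ), s ^ β * ((1 + s) * x + (l + m * s)) ^ (-(q + 1)) =
        1 / q * (s ^ β / (1 + s) * (l + m * s) ^ (-q)) := fun s hs => by
    have hs0 := hs.1
    obtain ⟨h1, h2⟩ := integral_Ioi_mul_add_rpow hq (k := 1 + s) (c := l + m * s)
      (by positivity) (by positivity)
    refine ⟨h1.const_mul _, ?_⟩
    rw [integral_const_mul, h2]
    field_simp
  have hnorm : ∀ s ∈ Set.Ioo (0 : ℝ) 1,
      ∫ x in Set.Ioi (0 : ℝ), ‖s ^ β * ((1 + s) * x + (l + m * s)) ^ (-(q + 1))‖ =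
        1 / q * (s ^ β / (1 + s) * (l + m * s) ^ (-q)) := fun s hs => by
    rw [← (hin s hs).2]
    refine setIntegral_congr_fun measurableSet_Ioi fun x hx => ?_
    have hx : 0 < x := hx
    have hs0 := hs.1
    exact Real.norm_of_nonneg (by positivity)
  have hout : IntegrableOn (fun s : ℝ => s ^ β / (1 + s) * (l + m * s) ^ (-q)) (Set.Ioo 0 1) := by
    have h0 : IntegrableOn (fun s : ℝ => s ^ β) (Set.Ioo 0 1) :=
      (intervalIntegral.integrableOn_Ioo_rpow_iff one_pos).2 hβ
    have := h0.mul_continuousOn_of_subset (g' := fun s : ℝ => (1 + s)⁻¹ * (l + m * s) ^ (-q))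
      (K := Set.Icc 0 1) ?_ measurableSet_Ioo isCompact_Icc Set.Ioo_subset_Icc_self
    · simpa only [div_eq_mul_inv, mul_assoc] using this
    · refine ContinuousOn.mul (ContinuousOn.inv₀ (by fun_prop) fun s hs => ?_)
        (ContinuousOn.rpow_const (by fun_prop) fun s hs => Or.inl ?_)
      all_goals
        have := hs.1
        positivity
  have hprod : Integrable (Function.uncurry fun x s : ℝ =>
      s ^ β * ((1 + s) * x + (l + m * s)) ^ (-(q + 1)))
      ((volume.restrict (Set.Ioi 0)).prod (volume.restrict (Set.Ioo 0 1))) := by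
    have hmeas : Measurable (Function.uncurry fun x s : ℝ =>
        s ^ β * ((1 + s) * x + (l + m * s)) ^ (-(q + 1))) := by
      simp only [Function.uncurry_def]
      fun_prop
    rw [integrable_prod_iff' hmeas.aestronglyMeasurable]
    refine ⟨ae_restrict_of_forall_mem measurableSet_Ioo fun s hs => (hin s hs).1, ?_⟩
    exact IntegrableOn.congr_fun (hout.const_mul (1 / q)) (fun s hs => (hnorm s hs).symm)
      measurableSet_Ioo
  refine ⟨hprod.integral_prod_left, ?_⟩
  rw [integral_integral_swap hprod, ← integral_const_mul]
  exact setIntegral_congr_fun measurableSet_Ioo fun s hs => (hin s hs).2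

/-! ### The expectation -/

/-- Up to a constant, the right-hand side is the expectation of `X / (X + Y)` over the event
`Y < X`, written in the variable `s = Y / X`. -/
theorem integral_Ioi_hypergeometric_add_one {q b l m : ℝ} (hq : 0 < q) (hb : 0 < b) (hl : 0 < l)
    (hm : 0 < m) :
    IntegrableOn (fun x : ℝ => ₂F₁ (q + 1) 1 (b + 1) ((x + m) / (2 * x + l + m)) /
      (2 * x + l + m) ^ (q + 1)) (Set.Ioi 0) ∧
    ∫ x in Set.Ioi (0 : ℝ), ₂F₁ (q + 1) 1 (b + 1) ((x + m) / (2 * x + l + m)) /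
        (2 * x + l + m) ^ (q + 1) =
      b / q * ∫ s in Set.Ioo (0 : ℝ) 1, s ^ (b - 1) / (1 + s) * (l + m * s) ^ (-q) := by
  obtain ⟨h1, h2⟩ := integral_Ioi_integral_Ioo_rpow (β := b - 1) (by linarith) hq hl hm
  have key : ∀ x ∈ Set.Ioi (0 : ℝ),
      b * ∫ s in Set.Ioo (0 : ℝ) 1, s ^ (b - 1) * ((x + l) + (x + m) * s) ^ (-(q + 1)) =
      ₂F₁ (q + 1) 1 (b + 1) ((x + m) / (2 * x + l + m)) / (2 * x + l + m) ^ (q + 1) := by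
    intro x hx
    have hx : 0 < x := hx
    rw [← hypergeometric_one_div_rpow_eq_integral (by positivity) hb hl hm hx,
      Real.rpow_neg (by positivity), ← div_eq_mul_inv]
  refine ⟨IntegrableOn.congr_fun (h1.const_mul b) key measurableSet_Ioi, ?_⟩
  rw [← setIntegral_congr_fun measurableSet_Ioi key, integral_const_mul, h2]
  ring

/-- Up to constants, the right-hand side is the boundary contribution of the integration by parts
plus the expectation of `Y / (X + Y)` over the event `Y < X`. -/
theorem integral_Ioi_hypergeometric_div_add {q b l m : ℝ} (hq : 0 < q) (hb : 0 < b) (hl : 0 < l)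
    (hm : 0 < m) (hz : |1 - (l + m) / (2 * m)| < 1) :
    IntegrableOn (fun x : ℝ => ₂F₁ q 1 (b + 1) ((x + m) / (2 * x + l + m)) /
      ((x + m) * (2 * x + l + m) ^ q)) (Set.Ioi 0) ∧
    ∫ x in Set.Ioi (0 : ℝ), ₂F₁ q 1 (b + 1) ((x + m) / (2 * x + l + m)) /
        ((x + m) * (2 * x + l + m) ^ q) =
      1 / (2 ^ q * m ^ q * q) * ₂F₁ q q (q + 1) (1 - (l + m) / (2 * m)) +
        ∫ s in Set.Ioo (0 : ℝ) 1, s ^ b / (1 + s) * (l + m * s) ^ (-q) := by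
  obtain ⟨h1, h2⟩ := integral_Ioi_integral_Ioo_rpow (β := b) (by linarith) hq hl hm
  obtain ⟨h3, h4⟩ := integral_Ioi_one_div_add_mul_rpow hq hl hm hz
  have key : ∀ x ∈ Set.Ioi (0 : ℝ),
      (2 * x + l + m) ^ (-q) / (x + m) +
        q * ∫ s in Set.Ioo (0 : ℝ) 1, s ^ b * ((x + l) + (x + m) * s) ^ (-(q + 1)) =
      ₂F₁ q 1 (b + 1) ((x + m) / (2 * x + l + m)) / ((x + m) * (2 * x + l + m) ^ q) := by
    intro x hx
    have hx : 0 < x := hx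
    have hxm : 0 < x + m := by positivity
    have hS : 0 < (2 * x + l + m) ^ q := by positivity
    have h := hypergeometric_one_div_rpow_eq_integral hq hb hl hm hx
    rw [integral_Ioo_rpow_mul_add_rpow_by_parts hb (by positivity) hxm,
      show x + l + (x + m) = 2 * x + l + m by ring, Real.rpow_neg (by positivity)] at h
    rw [Real.rpow_neg (by positivity)]
    field_simp at h ⊢
    linear_combination -h
  refine ⟨IntegrableOn.congr_fun (h3.add (h1.const_mul q)) key measurableSet_Ioi, ?_⟩
  rw [← setIntegral_congr_fun measurableSet_Ioi key, integral_add h3 (h1.const_mul q), h4,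
    integral_const_mul, h2]
  field_simp

theorem measurable_abs_one_sub_div_one_add : Measurable fun s : ℝ => |1 - s| / (1 + s) := by
  fun_prop

/-- The integral of `|1 - s| / (1 + s)` against `s ^ (b - 1) * (l + m * s) ^ (-q)`, split using
`|u| = -u + 2 * max u 0`. -/
theorem integral_Ioi_abs_one_sub_div_mul {q b l m : ℝ}
    (hA : IntegrableOn (fun s : ℝ => s ^ b / (1 + s) * (l + m * s) ^ (-q)) (Set.Ioi 0))
    (hD : IntegrableOn (fun s : ℝ => s ^ (b - 1) / (1 + s) * (l + m * s) ^ (-q)) (Set.Ioi 0)) :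
    IntegrableOn (fun s : ℝ => s ^ (b - 1) * (l + m * s) ^ (-q) * (|1 - s| / (1 + s)))
      (Set.Ioi 0) ∧
    ∫ s in Set.Ioi (0 : ℝ), s ^ (b - 1) * (l + m * s) ^ (-q) * (|1 - s| / (1 + s)) =
      (∫ s in Set.Ioi (0 : ℝ), s ^ b / (1 + s) * (l + m * s) ^ (-q)) -
      (∫ s in Set.Ioi (0 : ℝ), s ^ (b - 1) / (1 + s) * (l + m * s) ^ (-q)) +
      2 * ((∫ s in Set.Ioo (0 : ℝ) 1, s ^ (b - 1) / (1 + s) * (l + m * s) ^ (-q)) -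
        ∫ s in Set.Ioo (0 : ℝ) 1, s ^ b / (1 + s) * (l + m * s) ^ (-q)) := by
  set A : ℝ → ℝ := fun s => s ^ b / (1 + s) * (l + m * s) ^ (-q) with hAdef
  set D : ℝ → ℝ := fun s => s ^ (b - 1) / (1 + s) * (l + m * s) ^ (-q) with hDdef
  have hsub : Set.Ioo (0 : ℝ) 1 ⊆ Set.Ioi 0 := fun s hs => hs.1
  have hI : IntegrableOn ((Set.Iio (1 : ℝ)).indicator fun s => D s - A s) (Set.Ioi 0) :=
    IntegrableOn.indicator (hD.sub hA) measurableSet_Iio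
  have key : ∀ s ∈ Set.Ioi (0 : ℝ),
      (A s - D s) + 2 * (Set.Iio (1 : ℝ)).indicator (fun s => D s - A s) s =
      s ^ (b - 1) * (l + m * s) ^ (-q) * (|1 - s| / (1 + s)) := by
    intro s hs
    have hs : 0 < s := hs
    have hsb : s ^ b = s ^ (b - 1) * s := by
      rw [Real.rpow_sub_one hs.ne', div_mul_cancel₀ _ hs.ne']
    simp only [hAdef, hDdef]
    by_cases h1 : s < 1
    · rw [Set.indicator_of_mem (Set.mem_Iio.2 h1), abs_of_pos (by linarith), hsb]
      ring
    · rw [Set.indicator_of_notMem (by simpa using h1), abs_of_nonpos (by linarith), hsb]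
      ring
  have hAD : IntegrableOn (fun s => A s - D s) (Set.Ioi 0) := hA.sub hD
  refine ⟨IntegrableOn.congr_fun (hAD.add (hI.const_mul 2)) key measurableSet_Ioi, ?_⟩
  rw [← setIntegral_congr_fun measurableSet_Ioi key, integral_add hAD (hI.const_mul 2),
    integral_sub hA hD, integral_const_mul, setIntegral_indicator measurableSet_Iio,
    Set.Ioi_inter_Iio, integral_sub (hD.mono_set hsub) (hA.mono_set hsub)]

/-- `X ∼ Gamma(α₁, lam₁)` and `Y ∼ Gamma(α₂, lam₂)` (shape, rate) are independent real random
variables. The expectation of `|X - Y| / (X + Y)` and the two improper integrals on the right-hand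
side exist, and the expectation has the displayed value. -/
theorem mainTheorem7 {Ω : Type*} [MeasurableSpace Ω] (P : Measure Ω) [IsProbabilityMeasure P]
    (X Y : Ω → ℝ) (α₁ α₂ lam₁ lam₂ : ℝ)
    (hα₁ : 0 < α₁) (hα₂ : 0 < α₂) (hlam₁ : 0 < lam₁) (hlam₂ : 0 < lam₂)
    (hX : HasLaw X (gammaMeasure α₁ lam₁) P) (hY : HasLaw Y (gammaMeasure α₂ lam₂) P)
    (hXY : IndepFun X Y P)
    (hlow : 1 / 3 < lam₂ / lam₁) (hupp : lam₂ / lam₁ < 2) :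
    Integrable (fun ω => |X ω - Y ω| / (X ω + Y ω)) P ∧
    IntegrableOn (fun x : ℝ =>
      ₂F₁ (α₁ + α₂ + 1) 1 (α₂ + 1) ((x + lam₂) / (2 * x + lam₁ + lam₂)) /
        (2 * x + lam₁ + lam₂) ^ (α₁ + α₂ + 1)) (Set.Ioi 0) ∧
    IntegrableOn (fun x : ℝ =>
      ₂F₁ (α₁ + α₂) 1 (α₂ + 1) ((x + lam₂) / (2 * x + lam₁ + lam₂)) /
        ((x + lam₂) * (2 * x + lam₁ + lam₂) ^ (α₁ + α₂))) (Set.Ioi 0) ∧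
    ∫ ω, |X ω - Y ω| / (X ω + Y ω) ∂P =
      α₂ * lam₂ ^ α₂ / (lam₁ ^ α₂ * (α₁ + α₂)) *
          ₂F₁ (α₂ + 1) (α₁ + α₂) (α₁ + α₂ + 1) (1 - lam₂ / lam₁)
      - α₁ * lam₂ ^ α₂ / (lam₁ ^ α₂ * (α₁ + α₂)) *
          ₂F₁ α₂ (α₁ + α₂) (α₁ + α₂ + 1) (1 - lam₂ / lam₁)
      + 2 * lam₁ ^ α₁ * lam₂ ^ α₂ / beta α₁ (α₂ + 1) *
          (∫ x in Set.Ioi (0 : ℝ),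
            ₂F₁ (α₁ + α₂ + 1) 1 (α₂ + 1) ((x + lam₂) / (2 * x + lam₁ + lam₂)) /
              (2 * x + lam₁ + lam₂) ^ (α₁ + α₂ + 1))
      - 2 * lam₁ ^ α₁ * lam₂ ^ α₂ / beta α₁ α₂ *
          (∫ x in Set.Ioi (0 : ℝ),
            ₂F₁ (α₁ + α₂) 1 (α₂ + 1) ((x + lam₂) / (2 * x + lam₁ + lam₂)) /
              ((x + lam₂) * (2 * x + lam₁ + lam₂) ^ (α₁ + α₂)))
      + lam₁ ^ α₁ /
          ((2 : ℝ) ^ (α₁ + α₂ - 1) * lam₂ ^ α₁ * (α₁ + α₂) * beta α₁ α₂) *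
          ₂F₁ (α₁ + α₂) (α₁ + α₂) (α₁ + α₂ + 1) (1 - (lam₁ + lam₂) / (2 * lam₂)) := by
  have hq : 0 < α₁ + α₂ := add_pos hα₁ hα₂
  have hβ := beta_pos hα₁ hα₂
  have hlow' : lam₁ < 3 * lam₂ := by
    rw [div_lt_div_iff₀ three_pos hlam₁] at hlow
    linarith
  -- The two hypotheses on `lam₂ / lam₁` put the constant arguments of `₂F₁` in `(-1, 1)`.
  have hz : |1 - lam₂ / lam₁| < 1 := by
    have : 0 < lam₂ / lam₁ := by positivity
    rw [abs_lt]
    constructor <;> linarith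
  have hz' : |1 - (lam₁ + lam₂) / (2 * lam₂)| < 1 := by
    have h0 : 0 < (lam₁ + lam₂) / (2 * lam₂) := by positivity
    have h2 : (lam₁ + lam₂) / (2 * lam₂) < 2 := by
      rw [div_lt_iff₀ (by positivity)]
      linarith
    rw [abs_lt]
    constructor <;> linarith
  obtain ⟨h3, h3'⟩ := integral_Ioi_hypergeometric_add_one hq hα₂ hlam₁ hlam₂
  obtain ⟨h4, h4'⟩ := integral_Ioi_hypergeometric_div_add hq hα₂ hlam₁ hlam₂ hz'
  obtain ⟨hA, hA'⟩ := integral_Ioi_rpow_div_one_add_mul_rpow hq (e := α₂ + 1) (d := α₁)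
    (by positivity) hα₁ (by ring) hlam₁ hlam₂ hz
  obtain ⟨hD, hD'⟩ := integral_Ioi_rpow_div_one_add_mul_rpow hq (e := α₂) (d := α₁ + 1)
    hα₂ (by positivity) (by ring) hlam₁ hlam₂ hz
  rw [add_sub_cancel_right] at hA hA'
  obtain ⟨hW, hW'⟩ := integral_Ioi_abs_one_sub_div_mul hA hD
  have hlaw := map_div_eq_withDensity_of_gamma hα₁ hα₂ hlam₁ hlam₂ hX hY hXY
  have hdiv : AEMeasurable (fun ω => Y ω / X ω) P := hY.aemeasurable.div hX.aemeasurable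
  set C : ℝ := lam₁ ^ α₁ * lam₂ ^ α₂ / beta α₁ α₂ with hC
  have hC0 : 0 < C := by positivity
  let w : ℝ → ℝ := fun s => C * (s ^ (α₂ - 1) * (lam₁ + lam₂ * s) ^ (-(α₁ + α₂)))
  have hwm : Measurable fun s => ENNReal.ofReal (w s) := by fun_prop
  have hwlt : ∀ᵐ s ∂volume.restrict (Set.Ioi (0 : ℝ)), ENNReal.ofReal (w s) < ⊤ :=
    ae_of_all _ fun s => ENNReal.ofReal_lt_top
  have hw : ∀ s ∈ Set.Ioi (0 : ℝ), (ENNReal.ofReal (w s)).toReal • (|1 - s| / (1 + s)) =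
      C * (s ^ (α₂ - 1) * (lam₁ + lam₂ * s) ^ (-(α₁ + α₂)) * (|1 - s| / (1 + s))) := by
    intro s hs
    have hs : 0 < s := hs
    rw [ENNReal.toReal_ofReal (by positivity), smul_eq_mul]
    ring
  have hae : (fun ω => |1 - Y ω / X ω| / (1 + Y ω / X ω)) =ᵐ[P]
      fun ω => |X ω - Y ω| / (X ω + Y ω) := by
    filter_upwards [ae_pos_of_hasLaw_gammaMeasure hX, ae_pos_of_hasLaw_gammaMeasure hY]
      with ω hx hy
    have e1 : 1 - Y ω / X ω = (X ω - Y ω) / X ω := by field_simp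
    rw [e1, abs_div, abs_of_pos hx]
    field_simp
  have hint : Integrable (fun s : ℝ => |1 - s| / (1 + s)) (P.map fun ω => Y ω / X ω) := by
    rw [hlaw, integrable_withDensity_iff_integrable_smul' hwm hwlt]
    exact IntegrableOn.congr_fun (hW.const_mul C) (fun s hs => (hw s hs).symm) measurableSet_Ioi
  have hval : ∫ ω, |X ω - Y ω| / (X ω + Y ω) ∂P =
      C * ∫ s in Set.Ioi (0 : ℝ),
        s ^ (α₂ - 1) * (lam₁ + lam₂ * s) ^ (-(α₁ + α₂)) * (|1 - s| / (1 + s)) := by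
    rw [← integral_congr_ae hae, ← integral_map hdiv
      measurable_abs_one_sub_div_one_add.aestronglyMeasurable, hlaw,
      integral_withDensity_eq_integral_toReal_smul hwm hwlt,
      setIntegral_congr_fun measurableSet_Ioi hw, integral_const_mul]
  refine ⟨(hint.comp_aemeasurable hdiv).congr hae, h3, h4, ?_⟩
  rw [hval, hW', h3', h4', hA', hD', beta_add_one_left hα₂ hα₁, beta_add_one_right hα₂ hα₁,
    beta_add_one_right hα₁ hα₂, beta_comm α₂ α₁, add_comm α₂ α₁, hC, Real.rpow_neg hlam₁.le,
    Real.rpow_add hlam₁, Real.rpow_add hlam₂, Real.rpow_sub_one two_ne_zero]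
  have : 0 < (2 : ℝ) ^ (α₁ + α₂) := by positivity
  field_simp
  ring
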